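/- **Definitions.** A *Nelson algebra* is an algebra $\mathbf A=\langle A;\wedge,\vee,\to,{\sim},0,1\rangle$ such that $\langle A;\wedge,\vee,{\sim},0,1\rangle$ is a Kleene algebra, that is, $\langle A;\wedge,\vee,0,1\rangle$ is a bounded distributive lattice, ${\sim}{\sim}x=x$, ${\sim}(x\vee y)={\sim}x\wedge{\sim}y$, ${\sim}(x\wedge y)={\sim}x\vee{\sim}y$ and $x\wedge{\sim}x\le y\vee{\sim}y$, and such that for all $x,y,z\in A$ $$x\to x=1,\qquad {\sim}x\vee y\le x\to y,\qquad x\wedge({\sim}x\vee y)=x\wedge(x\to y),$$ $$x\to(y\wedge z)=(x\to y)\wedge(x\to z),\qquad x\to(y\to z)=(x\wedge y)\to z .$$ Subalgebras and isomorphisms are taken with respect to all the operations $\wedge,\vee,\to,{\sim},0,1$. Let $\lesssim$ be a quasiorder (a reflexive and transitive relation) on a set $U$, and put $[x)=\{y\in U: x\lesssim y\}$. For $X\subseteq U$ let $X^{\blacktriangledown}=\{x\in U:[x)\subseteq X\}$ and $X^{\blacktriangle}=\{x\in U:[x)\cap X\ne\emptyset\}$, and let $RS(\lesssim)=\{(X^{\blacktriangledown},X^{\blacktriangle}):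 X\subseteq U\}$, ordered coordinatewise by inclusion. This set is closed under the operations (where $A^c = U\setminus A$) $$(A,B)\wedge(C,D)=(A\cap C,B\cap D),\qquad (A,B)\vee(C,D)=(A\cup C,B\cup D),$$ $${\sim}(A,B)=(B^c,A^c),\qquad (A,B)\to(C,D)=\big((A^c\cup C)^{\blacktriangledown},\,A^c\cup D\big),$$ and with $0=(\emptyset,\emptyset)$ and $1=(U,U)$ it is a Nelson algebra, denoted $\mathbf{RS}(\lesssim)$. **Theorem.** Let $\mathbf A$ be a Nelson algebra. Then there exist a set $U$ and a quasiorder $\lesssim$ on $U$ such that $\mathbf A$ is isomorphic to a subalgebra of the Nelson algebra $\mathbf{RS}(\lesssim)$. -/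

import Mathlib

universe u

/-- A Nelson algebra: a Kleene algebra `⟨A; ⊓, ⊔, sneg, ⊥, ⊤⟩` (a bounded distributive lattice with
a De Morgan involution `sneg`, the strong negation, such that `x ⊓ ∼x ≤ y ⊔ ∼y`) together with a
binary operation `imp`, the weak implication, satisfying the identities of Brignole and Monteiro. -/
class NelsonAlgebra (A : Type u) extends DistribLattice A, BoundedOrder A where
  /-- the strong negation -/
  sneg : A → A
  /-- the weak implication -/
  imp : A → A → A
  sneg_sneg : ∀ x : A, sneg (sneg x) = x
  sneg_sup : ∀ x y : A, sneg (x ⊔ y) = sneg x ⊓ sneg y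
  sneg_inf : ∀ x y : A, sneg (x ⊓ y) = sneg x ⊔ sneg y
  inf_sneg_le_sup_sneg : ∀ x y : A, x ⊓ sneg x ≤ y ⊔ sneg y
  imp_self : ∀ x : A, imp x x = ⊤
  sneg_sup_le_imp : ∀ x y : A, sneg x ⊔ y ≤ imp x y
  inf_sneg_sup : ∀ x y : A, x ⊓ (sneg x ⊔ y) = x ⊓ imp x y
  imp_inf : ∀ x y z : A, imp x (y ⊓ z) = imp x y ⊓ imp x z
  imp_imp : ∀ x y z : A, imp x (imp y z) = imp (x ⊓ y) z

/-- An isomorphism of Nelson algebras: a bijection preserving all the operations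
`⊓, ⊔, imp, sneg, ⊥, ⊤`. -/
structure NelsonEquiv (A : Type*) (B : Type*) [NelsonAlgebra A] [NelsonAlgebra B]
    extends A ≃ B where
  map_inf' : ∀ x y : A, toFun (x ⊓ y) = toFun x ⊓ toFun y
  map_sup' : ∀ x y : A, toFun (x ⊔ y) = toFun x ⊔ toFun y
  map_imp' : ∀ x y : A, toFun (NelsonAlgebra.imp x y) = NelsonAlgebra.imp (toFun x) (toFun y)
  map_sneg' : ∀ x : A, toFun (NelsonAlgebra.sneg x) = NelsonAlgebra.sneg (toFun x)
  map_bot' : toFun ⊥ = ⊥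
  map_top' : toFun ⊤ = ⊤

/-- A subalgebra of a Nelson algebra: a subset closed under all the operations
`⊓, ⊔, imp, sneg, ⊥, ⊤`. -/
structure NelsonSubalgebra (A : Type*) [NelsonAlgebra A] where
  carrier : Set A
  inf_mem' : ∀ {x y : A}, x ∈ carrier → y ∈ carrier → x ⊓ y ∈ carrier
  sup_mem' : ∀ {x y : A}, x ∈ carrier → y ∈ carrier → x ⊔ y ∈ carrier
  imp_mem' : ∀ {x y : A}, x ∈ carrier → y ∈ carrier → NelsonAlgebra.imp x y ∈ carrier
  sneg_mem' : ∀ {x : A}, x ∈ carrier → NelsonAlgebra.sneg x ∈ carrier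
  bot_mem' : ⊥ ∈ carrier
  top_mem' : ⊤ ∈ carrier

/-- A subalgebra of a Nelson algebra is a Nelson algebra under the restricted operations. -/
instance NelsonSubalgebra.instNelsonAlgebra {A : Type*} [NelsonAlgebra A]
    (S : NelsonSubalgebra A) : NelsonAlgebra S.carrier where
  le x y := (x : A) ≤ (y : A)
  le_refl x := le_refl (x : A)
  le_trans x y z := le_trans (a := (x : A)) (b := (y : A)) (c := (z : A))
  lt_iff_le_not_ge x y := lt_iff_le_not_ge (a := (x : A)) (b := (y : A))
  le_antisymm _ _ h₁ h₂ := Subtype.ext (le_antisymm h₁ h₂)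
  inf x y := ⟨(x : A) ⊓ y, S.inf_mem' x.2 y.2⟩
  sup x y := ⟨(x : A) ⊔ y, S.sup_mem' x.2 y.2⟩
  inf_le_left x y := inf_le_left (a := (x : A)) (b := (y : A))
  inf_le_right x y := inf_le_right (a := (x : A)) (b := (y : A))
  le_inf _ _ _ h₁ h₂ := le_inf (α := A) h₁ h₂
  le_sup_left x y := le_sup_left (a := (x : A)) (b := (y : A))
  le_sup_right x y := le_sup_right (a := (x : A)) (b := (y : A))
  sup_le _ _ _ h₁ h₂ := sup_le (α := A) h₁ h₂
  le_sup_inf x y z := le_sup_inf (x := (x : A)) (y := (y : A)) (z := (z : A))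
  bot := ⟨⊥, S.bot_mem'⟩
  top := ⟨⊤, S.top_mem'⟩
  bot_le x := bot_le (a := (x : A))
  le_top x := le_top (a := (x : A))
  sneg x := ⟨NelsonAlgebra.sneg (x : A), S.sneg_mem' x.2⟩
  imp x y := ⟨NelsonAlgebra.imp (x : A) (y : A), S.imp_mem' x.2 y.2⟩
  sneg_sneg x := Subtype.ext (NelsonAlgebra.sneg_sneg (x : A))
  sneg_sup x y := Subtype.ext (NelsonAlgebra.sneg_sup (x : A) y)
  sneg_inf x y := Subtype.ext (NelsonAlgebra.sneg_inf (x : A) y)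
  inf_sneg_le_sup_sneg x y := NelsonAlgebra.inf_sneg_le_sup_sneg (x : A) y
  imp_self x := Subtype.ext (NelsonAlgebra.imp_self (x : A))
  sneg_sup_le_imp x y := NelsonAlgebra.sneg_sup_le_imp (x : A) y
  inf_sneg_sup x y := Subtype.ext (NelsonAlgebra.inf_sneg_sup (x : A) y)
  imp_inf x y z := Subtype.ext (NelsonAlgebra.imp_inf (x : A) y z)
  imp_imp x y z := Subtype.ext (NelsonAlgebra.imp_imp (x : A) y z)

section Rough

variable {U : Type u} [Preorder U]

/-- The lower approximation `{x ∈ U | [x) ⊆ X}` of `X`, where `[x) = {y | x ≲ y}`. -/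
def lowerApprox (X : Set U) : Set U := {x | Set.Ici x ⊆ X}

/-- The upper approximation `{x ∈ U | [x) ∩ X ≠ ∅}` of `X`, where `[x) = {y | x ≲ y}`. -/
def upperApprox (X : Set U) : Set U := {x | (Set.Ici x ∩ X).Nonempty}

variable (U) in
/-- The set `RS(≲)` of the rough sets `(lower approximation of X, upper approximation of X)`,
for `X ⊆ U`, determined by the quasiorder of `U`. -/
def RoughSet : Type u :=
  {p : Set U × Set U // ∃ X : Set U, (lowerApprox X, upperApprox X) = p}

/-- Two disjoint cofinal colour classes above the points all of whose successors have
a further successor. -/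
theorem exists_cofinal_split :
    ∃ C : Set U, ∀ x : U, (∀ y, x ≤ y → ∃ z, y ≤ z ∧ z ≠ y) →
      (∃ y, x ≤ y ∧ y ∈ C) ∧ (∃ y, x ≤ y ∧ y ∉ C) := by
  classical
  let F : Set (Set U × Set U) := {p | Disjoint p.1 p.2 ∧ (∀ a ∈ p.1, ∃ b ∈ p.2, a ≤ b) ∧
    (∀ b ∈ p.2, ∃ a ∈ p.1, b ≤ a)}
  obtain ⟨⟨P, Q⟩, ⟨hd, hPQ, hQP⟩, hmax⟩ : ∃ m, Maximal (· ∈ F) m := by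
    refine zorn_le₀ F fun c hc hchain => ?_
    refine ⟨(⋃ p ∈ c, p.1, ⋃ p ∈ c, p.2), ⟨?_, ?_, ?_⟩, ?_⟩
    · rw [Set.disjoint_left]
      intro a ha hb
      simp only [Set.mem_iUnion, exists_prop] at ha hb
      obtain ⟨p, hp, hap⟩ := ha
      obtain ⟨q, hq, haq⟩ := hb
      rcases hchain.total hp hq with h | h
      · exact Set.disjoint_left.1 (hc hq).1 (h.1 hap) haq
      · exact Set.disjoint_left.1 (hc hp).1 hap (h.2 haq)
    · intro a ha
      simp only [Set.mem_iUnion, exists_prop] at ha ⊢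
      obtain ⟨p, hp, hap⟩ := ha
      obtain ⟨b, hb, hab⟩ := (hc hp).2.1 a hap
      exact ⟨b, ⟨p, hp, hb⟩, hab⟩
    · intro a ha
      simp only [Set.mem_iUnion, exists_prop] at ha ⊢
      obtain ⟨p, hp, hap⟩ := ha
      obtain ⟨b, hb, hab⟩ := (hc hp).2.2 a hap
      exact ⟨b, ⟨p, hp, hb⟩, hab⟩
    · intro p hp
      exact ⟨Set.subset_biUnion_of_mem (u := fun p : Set U × Set U => p.1) hp,
        Set.subset_biUnion_of_mem (u := fun p : Set U × Set U => p.2) hp⟩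
  have hd' := Set.disjoint_left.1 hd
  refine ⟨P, fun x hx => ?_⟩
  suffices h : ∃ y, x ≤ y ∧ y ∈ P by
    obtain ⟨y, hxy, hy⟩ := h
    obtain ⟨z, hz, hyz⟩ := hPQ y hy
    exact ⟨⟨y, hxy, hy⟩, z, hxy.trans hyz, fun h => hd' h hz⟩
  by_contra hno
  have hnP : ∀ y, x ≤ y → y ∉ P := fun y hy h => hno ⟨y, hy, h⟩
  have hnQ : ∀ y, x ≤ y → y ∉ Q := fun y hy h => by
    obtain ⟨a, ha, hya⟩ := hQP y h
    exact hnP a (hy.trans hya) ha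
  -- a non-empty new pair above `x` contradicts maximality
  have key : ∀ P' Q' : Set U, P'.Nonempty → (∀ a ∈ P', x ≤ a) → (∀ a ∈ Q', x ≤ a) →
      Disjoint P' Q' → (∀ a ∈ P', ∃ b ∈ Q', a ≤ b) → (∀ b ∈ Q', ∃ a ∈ P', b ≤ a) → False := by
    intro P' Q' hne hP' hQ' hdis h₁ h₂
    have hdis' := Set.disjoint_left.1 hdis
    have hmem : (P ∪ P', Q ∪ Q') ∈ F := by
      refine ⟨?_, ?_, ?_⟩
      · rw [Set.disjoint_left]
        rintro a (ha | ha) (hb | hb)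
        · exact hd' ha hb
        · exact hnP a (hQ' a hb) ha
        · exact hnQ a (hP' a ha) hb
        · exact hdis' ha hb
      · rintro a (ha | ha)
        · obtain ⟨b, hb, h⟩ := hPQ a ha
          exact ⟨b, Or.inl hb, h⟩
        · obtain ⟨b, hb, h⟩ := h₁ a ha
          exact ⟨b, Or.inr hb, h⟩
      · rintro a (ha | ha)
        · obtain ⟨b, hb, h⟩ := hQP a ha
          exact ⟨b, Or.inl hb, h⟩
        · obtain ⟨b, hb, h⟩ := h₂ a ha
          exact ⟨b, Or.inr hb, h⟩
    have hle := hmax hmem ⟨Set.subset_union_left, Set.subset_union_left⟩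
    obtain ⟨a, ha⟩ := hne
    exact hnP a (hP' a ha) (hle.1 (Or.inr ha))
  by_cases hcl : ∃ y z, x ≤ y ∧ y ≤ z ∧ z ≤ y ∧ z ≠ y
  · obtain ⟨y, z, hxy, hyz, hzy, hne⟩ := hcl
    exact key {y} {z} ⟨y, rfl⟩ (by simpa using hxy) (by simpa using hxy.trans hyz)
      (by simpa using hne.symm) (by simpa using hyz) (by simpa using hzy)
  · have hstep : ∀ y : Set.Ici x, ∃ z : Set.Ici x, (y : U) < z := by
      rintro ⟨y, hy⟩
      obtain ⟨z, hyz, hne⟩ := hx y hy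
      exact ⟨⟨z, le_trans (Set.mem_Ici.1 hy) hyz⟩,
        lt_of_le_not_ge hyz fun h => hcl ⟨y, z, hy, hyz, h, hne⟩⟩
    choose f hf using hstep
    let s : ℕ → Set.Ici x := fun n => f^[n] ⟨x, Set.mem_Ici.2 le_rfl⟩
    have hs : StrictMono fun n => (s n : U) := strictMono_nat_of_lt_succ fun n => by
      simp only [s, Function.iterate_succ_apply']
      exact hf _
    refine key (Set.range fun n => (s (2 * n) : U)) (Set.range fun n => (s (2 * n + 1) : U))
      ⟨_, 0, rfl⟩ ?_ ?_ ?_ ?_ ?_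
    · rintro _ ⟨n, rfl⟩
      exact (s (2 * n)).2
    · rintro _ ⟨n, rfl⟩
      exact (s (2 * n + 1)).2
    · rw [Set.disjoint_left]
      rintro _ ⟨n, rfl⟩ ⟨m, hm⟩
      rcases lt_trichotomy (2 * m + 1) (2 * n) with h | h | h
      · exact absurd hm (hs h).ne
      · omega
      · exact absurd hm (hs h).ne'
    · rintro _ ⟨n, rfl⟩
      exact ⟨_, ⟨n, rfl⟩, (hs (Nat.lt_succ_self (2 * n))).le⟩
    · rintro _ ⟨n, rfl⟩
      exact ⟨_, ⟨n + 1, rfl⟩, (hs (show 2 * n + 1 < 2 * (n + 1) by omega)).le⟩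

/-- A pair `(A, B)` is a rough set iff `A` is an up-set, `B` is a down-set, `A ⊆ B`, and every
singleton (a point with `[x) = {x}`) in `B` lies in `A`. -/
theorem isRoughSet_iff (A B : Set U) :
    (∃ X : Set U, (lowerApprox X, upperApprox X) = (A, B)) ↔
      IsUpperSet A ∧ IsLowerSet B ∧ A ⊆ B ∧ ∀ x, (∀ y, x ≤ y → y = x) → x ∈ B → x ∈ A := by
  constructor
  · rintro ⟨X, hX⟩
    obtain ⟨rfl, rfl⟩ := Prod.mk.inj hX
    refine ⟨fun x y hxy hx z hz => hx (le_trans hxy hz), ?_, ?_, ?_⟩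
    · rintro x y hyx ⟨z, hz, hzX⟩
      exact ⟨z, le_trans hyx hz, hzX⟩
    · exact fun x hx => ⟨x, le_rfl, hx (Set.mem_Ici.2 le_rfl)⟩
    · rintro x hx ⟨z, hz, hzX⟩ y hy
      rw [hx y hy, ← hx z hz]
      exact hzX
  · rintro ⟨hA, hB, hAB, hS⟩
    obtain ⟨C, hC⟩ := exists_cofinal_split (U := U)
    have hV : ∀ x, (∀ y, x ≤ y → y ∈ B ∧ y ∉ A) →
        (∃ y, x ≤ y ∧ y ∈ C) ∧ (∃ y, x ≤ y ∧ y ∉ C) := by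
      refine fun x hx => hC x fun y hy => ?_
      by_contra hno
      push Not at hno
      exact (hx y hy).2 (hS y hno (hx y hy).1)
    refine ⟨A ∪ {x | x ∈ B ∧ (∀ y, x ≤ y → y ∉ A) ∧ ((∃ y, x ≤ y ∧ y ∉ B) ∨ x ∈ C)}, ?_⟩
    refine Prod.ext (Set.ext fun x => ⟨fun hx => ?_, fun hx y hy => Or.inl (hA hy hx)⟩)
      (Set.ext fun x => ⟨?_, fun hx => ?_⟩)
    · rcases hx (Set.mem_Ici.2 le_rfl) with h | ⟨hxB, hxA, hx'⟩
      · exact h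
      · exfalso
        by_cases hsub : ∃ y, x ≤ y ∧ y ∉ B
        · obtain ⟨y, hy, hyB⟩ := hsub
          rcases hx (Set.mem_Ici.2 hy) with h | h
          · exact hyB (hAB h)
          · exact hyB h.1
        · push Not at hsub
          obtain ⟨y, hy, hyC⟩ := (hV x fun y hy => ⟨hsub y hy, hxA y hy⟩).2
          rcases hx (Set.mem_Ici.2 hy) with h | ⟨_, _, ⟨z, hz, hzB⟩ | h⟩
          · exact hxA y hy h
          · exact hzB (hsub z (hy.trans hz))
          · exact hyC h
    · rintro ⟨y, hy, h | h⟩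
      · exact hB hy (hAB h)
      · exact hB hy h.1
    · by_cases hmeet : ∃ y, x ≤ y ∧ y ∈ A
      · obtain ⟨y, hy, hyA⟩ := hmeet
        exact ⟨y, hy, Or.inl hyA⟩
      · push Not at hmeet
        by_cases hsub : ∃ y, x ≤ y ∧ y ∉ B
        · exact ⟨x, le_rfl, Or.inr ⟨hx, hmeet, Or.inl hsub⟩⟩
        · push Not at hsub
          obtain ⟨y, hy, hyC⟩ := (hV x fun y hy => ⟨hsub y hy, hmeet y hy⟩).1
          exact ⟨y, hy, Or.inr ⟨hsub y hy, fun z hz => hmeet z (hy.trans hz), Or.inr hyC⟩⟩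

namespace RoughSet

theorem ext {p q : RoughSet U} (h₁ : p.1.1 = q.1.1) (h₂ : p.1.2 = q.1.2) : p = q :=
  Subtype.ext (Prod.ext h₁ h₂)

theorem spec (p : RoughSet U) : IsUpperSet p.1.1 ∧ IsLowerSet p.1.2 ∧ p.1.1 ⊆ p.1.2 ∧
    ∀ x, (∀ y, x ≤ y → y = x) → x ∈ p.1.2 → x ∈ p.1.1 :=
  (isRoughSet_iff p.1.1 p.1.2).1 p.2

/-- Meet: `(A, B) ∧ (C, D) = (A ∩ C, B ∩ D)`. -/
def inf (p q : RoughSet U) : RoughSet U :=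
  ⟨(p.1.1 ∩ q.1.1, p.1.2 ∩ q.1.2), (isRoughSet_iff _ _).2
    ⟨p.spec.1.inter q.spec.1, p.spec.2.1.inter q.spec.2.1,
      Set.inter_subset_inter p.spec.2.2.1 q.spec.2.2.1,
      fun x hx h => ⟨p.spec.2.2.2 x hx h.1, q.spec.2.2.2 x hx h.2⟩⟩⟩

/-- Join: `(A, B) ∨ (C, D) = (A ∪ C, B ∪ D)`. -/
def sup (p q : RoughSet U) : RoughSet U :=
  ⟨(p.1.1 ∪ q.1.1, p.1.2 ∪ q.1.2), (isRoughSet_iff _ _).2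
    ⟨p.spec.1.union q.spec.1, p.spec.2.1.union q.spec.2.1,
      Set.union_subset_union p.spec.2.2.1 q.spec.2.2.1,
      fun x hx h => h.imp (p.spec.2.2.2 x hx) (q.spec.2.2.2 x hx)⟩⟩

/-- Strong negation: `∼(A, B) = (Bᶜ, Aᶜ)`. -/
def sneg (p : RoughSet U) : RoughSet U :=
  ⟨(p.1.2ᶜ, p.1.1ᶜ), (isRoughSet_iff _ _).2
    ⟨p.spec.2.1.compl, p.spec.1.compl, Set.compl_subset_compl.2 p.spec.2.2.1,
      fun x hx h h' => h (p.spec.2.2.2 x hx h')⟩⟩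

/-- Weak implication: `(A, B) → (C, D)` is the pair of the lower approximation of `Aᶜ ∪ C` and of
`Aᶜ ∪ D`. -/
def imp (p q : RoughSet U) : RoughSet U :=
  ⟨(lowerApprox (p.1.1ᶜ ∪ q.1.1), p.1.1ᶜ ∪ q.1.2), (isRoughSet_iff _ _).2
    ⟨fun x y hxy hx z hz => hx (le_trans hxy hz), p.spec.1.compl.union q.spec.2.1,
      fun x hx => (hx (Set.mem_Ici.2 le_rfl)).imp id fun h => q.spec.2.2.1 h,
      fun x hx h y hy => by
        rw [hx y hy]
        exact h.imp id (q.spec.2.2.2 x hx)⟩⟩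

/-- The Nelson algebra `⟨RS; ∧, ∨, →, ∼, (∅, ∅), (U, U)⟩` of the rough sets determined by
a quasiorder, ordered coordinatewise. -/
instance instNelsonAlgebra : NelsonAlgebra (RoughSet U) where
  le p q := p.1.1 ⊆ q.1.1 ∧ p.1.2 ⊆ q.1.2
  le_refl _ := ⟨subset_rfl, subset_rfl⟩
  le_trans _ _ _ h₁ h₂ := ⟨h₁.1.trans h₂.1, h₁.2.trans h₂.2⟩
  le_antisymm _ _ h₁ h₂ := ext (h₁.1.antisymm h₂.1) (h₁.2.antisymm h₂.2)
  inf := inf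
  sup := sup
  inf_le_left _ _ := ⟨Set.inter_subset_left, Set.inter_subset_left⟩
  inf_le_right _ _ := ⟨Set.inter_subset_right, Set.inter_subset_right⟩
  le_inf _ _ _ h₁ h₂ := ⟨Set.subset_inter h₁.1 h₂.1, Set.subset_inter h₁.2 h₂.2⟩
  le_sup_left _ _ := ⟨Set.subset_union_left, Set.subset_union_left⟩
  le_sup_right _ _ := ⟨Set.subset_union_right, Set.subset_union_right⟩
  sup_le _ _ _ h₁ h₂ := ⟨Set.union_subset h₁.1 h₂.1, Set.union_subset h₁.2 h₂.2⟩
  le_sup_inf p q r := ⟨(Set.union_inter_distrib_left p.1.1 q.1.1 r.1.1).symm.subset,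
    (Set.union_inter_distrib_left p.1.2 q.1.2 r.1.2).symm.subset⟩
  bot := ⟨(∅, ∅), (isRoughSet_iff _ _).2
    ⟨isUpperSet_empty, isLowerSet_empty, subset_rfl, fun _ _ h => h⟩⟩
  top := ⟨(Set.univ, Set.univ), (isRoughSet_iff _ _).2
    ⟨isUpperSet_univ, isLowerSet_univ, subset_rfl, fun _ _ h => h⟩⟩
  bot_le _ := ⟨Set.empty_subset _, Set.empty_subset _⟩
  le_top _ := ⟨Set.subset_univ _, Set.subset_univ _⟩
  sneg := sneg
  imp := imp
  sneg_sneg _ := ext (compl_compl _) (compl_compl _)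
  sneg_sup _ _ := ext (Set.compl_union _ _) (Set.compl_union _ _)
  sneg_inf _ _ := ext (Set.compl_inter _ _) (Set.compl_inter _ _)
  inf_sneg_le_sup_sneg p q :=
    ⟨fun x hx => absurd (p.spec.2.2.1 hx.1) hx.2, fun x _ =>
      (em (x ∈ q.1.1)).imp (fun h => q.spec.2.2.1 h) id⟩
  imp_self p := ext
    (Set.eq_univ_of_forall fun x y _ => (em (y ∈ p.1.1)).symm.imp id id)
    (Set.eq_univ_of_forall fun x => (em (x ∈ p.1.1)).symm.imp id fun h => p.spec.2.2.1 h)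
  sneg_sup_le_imp p q :=
    ⟨fun x hx y hy => hx.elim (fun h => Or.inl fun h' =>
        h (p.spec.2.1 hy (p.spec.2.2.1 h'))) (fun h => Or.inr (q.spec.1 hy h)), subset_rfl⟩
  inf_sneg_sup p q := ext
    (Set.ext fun x => ⟨fun hx => ⟨hx.1, fun y hy => hx.2.elim
        (fun h => absurd (p.spec.2.2.1 hx.1) h) (fun h => Or.inr (q.spec.1 hy h))⟩,
      fun hx => ⟨hx.1, (hx.2 (Set.mem_Ici.2 le_rfl)).elim (fun h => absurd hx.1 h) Or.inr⟩⟩)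
    rfl
  imp_inf p q r := ext
    (Set.ext fun x => ⟨fun hx => ⟨fun y hy => (hx hy).imp id And.left,
        fun y hy => (hx hy).imp id And.right⟩,
      fun hx y hy => (hx.1 hy).elim Or.inl fun h => (hx.2 hy).imp id fun h' => ⟨h, h'⟩⟩)
    (Set.union_inter_distrib_left _ _ _)
  imp_imp p q r := ext
    (Set.ext fun x => ⟨fun hx y hy => (hx hy).elim (fun h => Or.inl fun h' => h h'.1)
        fun h => (h (Set.mem_Ici.2 le_rfl)).imp (fun h h' => h h'.2) id,
      fun hx y hy => (em (y ∈ p.1.1)).symm.imp id fun h z hz =>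
        (hx (Set.mem_Ici.2 (le_trans (Set.mem_Ici.1 hy) hz))).imp
          (fun h' hq => h' ⟨p.spec.1 hz h, hq⟩) id⟩)
    ((Set.union_assoc _ _ _).symm.trans
      (congrArg (· ∪ r.1.2) (Set.compl_inter _ _).symm))

/-- The implication of rough sets is the weak relative pseudocomplement: `p → q` is the greatest
`z` with `p ∧ z ≤ ∼p ∨ q`. -/
theorem le_imp_iff (p q z : RoughSet U) :
    z ≤ NelsonAlgebra.imp p q ↔ p ⊓ z ≤ NelsonAlgebra.sneg p ⊔ q := by
  constructor
  · intro h
    refine ⟨fun x hx => Or.inr ?_, fun x hx => h.2 hx.2⟩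
    exact (h.1 hx.2 (Set.mem_Ici.2 le_rfl)).elim (fun h' => absurd hx.1 h') id
  · intro h
    refine ⟨fun x hx y hy => ?_, fun x hx => ?_⟩
    · by_cases hp : y ∈ p.1.1
      · exact (h.1 ⟨hp, z.spec.1 hy hx⟩).elim
          (fun h' => absurd (p.spec.2.2.1 hp) h') Or.inr
      · exact Or.inl hp
    · by_cases hp : x ∈ p.1.1
      · exact h.2 ⟨p.spec.2.2.1 hp, hx⟩
      · exact Or.inl hp

end RoughSet

end Rough

/-- A prime filter of a bounded lattice, as a set of elements. -/
structure IsPrimeFilter {α : Type*} [Lattice α] [BoundedOrder α] (F : Set α) : Prop where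
  top_mem : ⊤ ∈ F
  bot_notMem : ⊥ ∉ F
  inf_mem_iff : ∀ {x y : α}, x ⊓ y ∈ F ↔ x ∈ F ∧ y ∈ F
  sup_mem_iff : ∀ {x y : α}, x ⊔ y ∈ F ↔ x ∈ F ∨ y ∈ F

namespace IsPrimeFilter

theorem mem_of_le {α : Type*} [Lattice α] [BoundedOrder α] {F : Set α} (hF : IsPrimeFilter F)
    {x y : α} (hx : x ∈ F) (hxy : x ≤ y) : y ∈ F :=
  (hF.inf_mem_iff.1 (by rwa [inf_eq_left.2 hxy] : x ⊓ y ∈ F)).2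

theorem exists_of_disjoint {α : Type*} [DistribLattice α] [BoundedOrder α] {H J : Set α}
    (hH : Order.IsPFilter H) (hJ : Order.IsIdeal J) (hHJ : Disjoint H J) :
    ∃ G : Set α, IsPrimeFilter G ∧ H ⊆ G ∧ Disjoint G J := by
  obtain ⟨I, hI, hJI, hHI⟩ := DistribLattice.prime_ideal_of_disjoint_filter_ideal
    (F := hH.toPFilter) (I := hJ.toIdeal) hHJ
  refine ⟨(I : Set α)ᶜ, ⟨?_, fun h => h I.bot_mem, ?_, ?_⟩, ?_, ?_⟩
  · exact hI.toIsProper.top_notMem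
  · intro x y
    simp only [Set.mem_compl_iff, SetLike.mem_coe]
    refine ⟨fun h => ⟨fun hx => h (I.lower inf_le_left hx), fun hy => h (I.lower inf_le_right hy)⟩,
      fun h hxy => (hI.mem_or_mem hxy).elim h.1 h.2⟩
  · intro x y
    simp only [Set.mem_compl_iff, SetLike.mem_coe, Order.Ideal.sup_mem_iff]
    tauto
  · exact fun x hx hxI => Set.disjoint_left.1 hHI hx hxI
  · exact Set.disjoint_left.2 fun x hx hxJ => hx (hJI hxJ)

end IsPrimeFilter

namespace NelsonAlgebra

section Arithmetic

variable {A : Type*} [NelsonAlgebra A]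

theorem sneg_le_sneg {x y : A} (h : x ≤ y) : sneg y ≤ sneg x := by
  rw [← sup_eq_right.2 h, sneg_sup]
  exact inf_le_left

theorem sneg_le_comm {x y : A} (h : sneg x ≤ y) : sneg y ≤ x := by
  simpa only [sneg_sneg] using sneg_le_sneg h

theorem sneg_top : sneg (⊤ : A) = ⊥ :=
  le_bot_iff.1 (sneg_le_comm le_top)

theorem sneg_bot : sneg (⊥ : A) = ⊤ := by
  rw [← sneg_top, sneg_sneg]

theorem imp_mono_right (x : A) {y z : A} (h : y ≤ z) : imp x y ≤ imp x z := by
  rw [← inf_eq_left.2 h, imp_inf]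
  exact inf_le_right

theorem inf_imp_le (x y : A) : x ⊓ imp x y ≤ sneg x ⊔ y := by
  rw [← inf_sneg_sup]
  exact inf_le_right

/-- The weak implication is a weak relative pseudocomplement. -/
theorem le_imp_iff {x y z : A} : z ≤ imp x y ↔ x ⊓ z ≤ sneg x ⊔ y := by
  refine ⟨fun h => (inf_le_inf_left x h).trans (inf_imp_le x y), fun h => ?_⟩
  have inf_left : ∀ w : A, imp x (x ⊓ w) = imp x w := fun w => by
    rw [imp_inf, imp_self, top_inf_eq]
  calc z ≤ imp x z := le_sup_right.trans (sneg_sup_le_imp x z)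
    _ = imp x (x ⊓ z) := (inf_left z).symm
    _ ≤ imp x (sneg x ⊔ y) := imp_mono_right x h
    _ = imp x (x ⊓ imp x y) := by rw [← inf_left, inf_sneg_sup]
    _ = imp x y := by rw [inf_left, imp_imp, inf_idem]

theorem imp_anti_left {x y : A} (h : x ≤ y) (z : A) : imp y z ≤ imp x z :=
  le_imp_iff.2 <| (inf_le_inf_right _ h).trans <| (inf_imp_le y z).trans <|
    sup_le_sup_right (sneg_le_sneg h) z

theorem inf_imp_inf_imp_le (x y z : A) : x ⊓ (imp x z ⊓ imp y z) ≤ sneg y ⊔ z := by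
  have hx : x ⊓ (imp x z ⊓ imp y z) ≤ sneg y ⊔ z ⊔ y :=
    calc x ⊓ (imp x z ⊓ imp y z) ≤ x ⊓ (sneg x ⊔ z) := by
          rw [inf_sneg_sup]
          exact inf_le_inf_left x inf_le_left
      _ ≤ x ⊓ sneg x ⊔ z := by
          rw [inf_sup_left]
          exact sup_le_sup_left inf_le_right _
      _ ≤ (y ⊔ sneg y) ⊔ z := sup_le_sup_right (inf_sneg_le_sup_sneg x y) z
      _ = sneg y ⊔ z ⊔ y := by ac_rfl
  have hy : y ⊓ (x ⊓ (imp x z ⊓ imp y z)) ≤ sneg y ⊔ z :=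
    (inf_le_inf_left y (inf_le_right.trans inf_le_right)).trans (inf_imp_le y z)
  calc x ⊓ (imp x z ⊓ imp y z)
      ≤ (x ⊓ (imp x z ⊓ imp y z)) ⊓ (sneg y ⊔ z ⊔ y) := le_inf le_rfl hx
    _ ≤ sneg y ⊔ z := by
      rw [inf_sup_left]
      exact sup_le inf_le_right (by rwa [inf_comm])

theorem imp_inf_imp_le_imp_sup (x y z : A) : imp x z ⊓ imp y z ≤ imp (x ⊔ y) z := by
  rw [le_imp_iff, sneg_sup, inf_sup_right, sup_inf_right (sneg x)]
  refine sup_le (le_inf ?_ (inf_imp_inf_imp_le x y z))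
    (le_inf ?_ ?_)
  · exact (inf_le_inf_left x inf_le_left).trans (inf_imp_le x z)
  · rw [inf_comm (imp x z)]
    exact inf_imp_inf_imp_le y x z
  · exact (inf_le_inf_left y inf_le_right).trans (inf_imp_le y z)

theorem inf_sneg_imp_eq_top (x y : A) : imp (x ⊓ sneg x) y = ⊤ := by
  rw [← top_le_iff, le_imp_iff, sneg_inf, sneg_sneg]
  exact inf_le_left.trans (inf_le_left.trans (le_sup_right.trans le_sup_left))

end Arithmetic

/-- A prime filter containing no element together with its strong negation. -/
structure IsConsistentPrime {A : Type*} [NelsonAlgebra A] (F : Set A) : Prop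
    extends IsPrimeFilter F where
  sneg_notMem : ∀ {x : A}, x ∈ F → sneg x ∉ F

namespace IsConsistentPrime

variable {A : Type*} [NelsonAlgebra A] {F : Set A}

theorem mem_of_imp_mem (hF : IsConsistentPrime F) {a b : A} (hab : imp a b ∈ F) (ha : a ∈ F) :
    b ∈ F :=
  (hF.sup_mem_iff.1 (hF.mem_of_le (hF.inf_mem_iff.2 ⟨ha, hab⟩) (inf_imp_le a b))).resolve_left
    (hF.sneg_notMem ha)

theorem exists_of_imp_notMem (hF : IsConsistentPrime F) {a b : A} (hab : imp a b ∉ F) :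
    ∃ G : Set A, IsConsistentPrime G ∧ F ⊆ G ∧ a ∈ G ∧ b ∉ G := by
  have hH : Order.IsPFilter {c : A | ∃ f ∈ F, f ⊓ a ≤ c} := by
    refine Order.IsPFilter.of_def ⟨⊤, ⊤, hF.top_mem, le_top⟩ ?_ ?_
    · rintro c ⟨f, hf, hfc⟩ d ⟨g, hg, hgd⟩
      refine ⟨c ⊓ d, ⟨f ⊓ g, hF.inf_mem_iff.2 ⟨hf, hg⟩, le_inf ?_ ?_⟩, inf_le_left, inf_le_right⟩
      · exact (inf_le_inf_right a inf_le_left).trans hfc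
      · exact (inf_le_inf_right a inf_le_right).trans hgd
    · rintro c d hcd ⟨f, hf, hfc⟩
      exact ⟨f, hf, hfc.trans hcd⟩
  have hJ : Order.IsIdeal {d : A | imp d (imp a b) ∈ F} := by
    refine ⟨fun c d hdc hc => hF.mem_of_le hc (imp_anti_left hdc _), ⟨⊥, ?_⟩, ?_⟩
    · refine hF.mem_of_le hF.top_mem ((le_sup_left.trans (sneg_sup_le_imp ⊥ _)).trans' ?_)
      rw [sneg_bot]
    · exact fun c hc d hd => ⟨c ⊔ d, hF.mem_of_le (hF.inf_mem_iff.2 ⟨hc, hd⟩)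
        (imp_inf_imp_le_imp_sup c d _), le_sup_left, le_sup_right⟩
  obtain ⟨G, hG, hHG, hGJ⟩ := IsPrimeFilter.exists_of_disjoint hH hJ <|
    Set.disjoint_left.2 fun d hdH hdJ => by
      obtain ⟨f, hf, hfd⟩ := hdH
      refine hab (hF.mem_of_imp_mem ?_ hf)
      have := hF.mem_of_le hdJ (imp_anti_left hfd (imp a b))
      rwa [imp_imp, inf_assoc, inf_idem, ← imp_imp] at this
  have hGJ' := Set.disjoint_left.1 hGJ
  refine ⟨G, ⟨hG, fun {x} hx hx' => ?_⟩, fun f hf => hHG ⟨f, hf, inf_le_left⟩,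
    hHG ⟨⊤, hF.top_mem, inf_le_right⟩, fun hb => ?_⟩
  · refine hGJ' (hG.inf_mem_iff.2 ⟨hx, hx'⟩) ?_
    rw [Set.mem_ofPred_eq, inf_sneg_imp_eq_top]
    exact hF.top_mem
  · refine hGJ' hb ?_
    rw [Set.mem_ofPred_eq, imp_imp, inf_comm, ← imp_imp, imp_self]
    exact hF.mem_of_le hF.top_mem (le_sup_right.trans (sneg_sup_le_imp a ⊤))

theorem imp_mem_iff (hF : IsConsistentPrime F) {a b : A} :
    imp a b ∈ F ↔ ∀ G : Set A, IsConsistentPrime G → F ⊆ G → a ∈ G → b ∈ G := by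
  refine ⟨fun h G hG hFG ha => hG.mem_of_imp_mem (hFG h) ha, fun h => ?_⟩
  by_contra hab
  obtain ⟨G, hG, hFG, ha, hb⟩ := hF.exists_of_imp_notMem hab
  exact hb (h G hG hFG ha)

theorem sneg_imp_mem_iff (hF : IsConsistentPrime F) {a b : A} :
    sneg (imp a b) ∈ F ↔ a ∈ F ∧ sneg b ∈ F := by
  constructor
  · intro h
    have := hF.mem_of_le h (sneg_le_sneg (sneg_sup_le_imp a b))
    rwa [sneg_sup, sneg_sneg, hF.inf_mem_iff] at this
  · rintro ⟨ha, hb⟩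
    have := sneg_le_sneg (inf_imp_le a b)
    rw [sneg_sup, sneg_sneg, sneg_inf] at this
    exact (hF.sup_mem_iff.1 (hF.mem_of_le (hF.inf_mem_iff.2 ⟨ha, hb⟩) this)).resolve_left
      (hF.sneg_notMem ha)

end IsConsistentPrime

section Separation

variable {A : Type*} [NelsonAlgebra A]

theorem _root_.IsPrimeFilter.sneg_preimage_compl {P : Set A} (hP : IsPrimeFilter P) :
    IsPrimeFilter {x : A | sneg x ∉ P} where
  top_mem := by simpa [sneg_top] using hP.bot_notMem
  bot_notMem := by simpa [sneg_bot] using hP.top_mem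
  inf_mem_iff := by simp [sneg_inf, hP.sup_mem_iff]
  sup_mem_iff := by
    intro x y
    simp only [sneg_sup, Set.mem_ofPred_eq, hP.inf_mem_iff]
    tauto

/-- Elements which no consistent prime filter distinguishes, neither directly nor through
their strong negations, are in order. -/
theorem le_of_forall_isConsistentPrime {a b : A}
    (h₁ : ∀ F : Set A, IsConsistentPrime F → a ∈ F → b ∈ F)
    (h₂ : ∀ F : Set A, IsConsistentPrime F → sneg b ∈ F → sneg a ∈ F) : a ≤ b := by
  by_contra hab
  obtain ⟨P, hP, haP, hPb⟩ := IsPrimeFilter.exists_of_disjoint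
    (Order.PFilter.principal a).isPFilter (Order.Ideal.principal b).isIdeal
    (Set.disjoint_left.2 fun x hx hx' => hab (le_trans hx hx'))
  have ha : a ∈ P := haP (le_refl a)
  have hb : b ∉ P := fun hb => Set.disjoint_left.1 hPb hb (le_refl b)
  by_cases hc : ∀ x ∈ P, sneg x ∉ P
  · exact hb (h₁ P ⟨hP, hc _⟩ ha)
  · push Not at hc
    obtain ⟨x, hx, hx'⟩ := hc
    refine h₂ {y | sneg y ∉ P} ⟨hP.sneg_preimage_compl, fun {y} hy hy' => ?_⟩
      (by simpa [sneg_sneg] using hb) (by simpa [sneg_sneg] using ha)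
    rw [Set.mem_ofPred_eq, sneg_sneg] at hy'
    exact (hP.sup_mem_iff.1 (hP.mem_of_le (hP.inf_mem_iff.2 ⟨hx, hx'⟩)
      (inf_sneg_le_sup_sneg x y))).elim hy' hy

end Separation

section Representation

variable (A : Type u) [NelsonAlgebra A]

/-- The points of the representing space: two copies of every consistent prime filter. -/
def Point : Type u := {F : Set A // IsConsistentPrime F} × Bool

instance : Preorder (Point A) := Preorder.lift fun p => p.1.1

variable {A}

theorem Point.exists_ne (p : Point A) : ∃ q : Point A, p ≤ q ∧ q ≠ p :=
  ⟨(p.1, !p.2), le_refl p.1.1, fun h => by simpa using congrArg Prod.snd h⟩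

/-- The rough set of the pairs of points containing `a`, respectively not containing `∼a`. -/
def toRoughSet (a : A) : RoughSet (Point A) :=
  ⟨({p | a ∈ p.1.1}, {p | sneg a ∉ p.1.1}), (isRoughSet_iff _ _).2
    ⟨fun _ _ hpq h => hpq h, fun _ _ hqp h h' => h (hqp h'), fun p h => p.1.2.sneg_notMem h,
      fun p hp => by
        obtain ⟨q, hpq, hne⟩ := p.exists_ne
        exact absurd (hp q hpq) hne⟩⟩

theorem toRoughSet_injective : Function.Injective (toRoughSet (A := A)) := by
  have key : ∀ a b : A, toRoughSet a = toRoughSet b → a ≤ b := fun a b h =>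
    le_of_forall_isConsistentPrime
      (fun F hF ha => (Set.ext_iff.1 (congrArg (·.1.1) h) (⟨F, hF⟩, true)).1 ha)
      (fun F hF hb => by
        by_contra ha
        exact (Set.ext_iff.1 (congrArg (·.1.2) h) (⟨F, hF⟩, true)).1 ha hb)
  exact fun a b h => le_antisymm (key a b h) (key b a h.symm)

theorem toRoughSet_inf (a b : A) : toRoughSet (a ⊓ b) = toRoughSet a ⊓ toRoughSet b :=
  RoughSet.ext (Set.ext fun p => p.1.2.inf_mem_iff)
    (Set.ext fun p => p.1.2.sneg_preimage_compl.inf_mem_iff)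

theorem toRoughSet_sup (a b : A) : toRoughSet (a ⊔ b) = toRoughSet a ⊔ toRoughSet b :=
  RoughSet.ext (Set.ext fun p => p.1.2.sup_mem_iff)
    (Set.ext fun p => p.1.2.sneg_preimage_compl.sup_mem_iff)

theorem toRoughSet_sneg (a : A) : toRoughSet (sneg a) = sneg (toRoughSet a) :=
  RoughSet.ext (Set.ext fun _ => not_not.symm)
    (Set.ext fun p => by
      change sneg (sneg a) ∉ p.1.1 ↔ a ∉ p.1.1
      rw [sneg_sneg])

theorem toRoughSet_bot : toRoughSet (⊥ : A) = ⊥ :=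
  RoughSet.ext (Set.eq_empty_of_forall_notMem fun p => p.1.2.bot_notMem)
    (Set.eq_empty_of_forall_notMem fun p => p.1.2.sneg_preimage_compl.bot_notMem)

theorem toRoughSet_top : toRoughSet (⊤ : A) = ⊤ :=
  RoughSet.ext (Set.eq_univ_of_forall fun p => p.1.2.top_mem)
    (Set.eq_univ_of_forall fun p => p.1.2.sneg_preimage_compl.top_mem)

theorem toRoughSet_imp (a b : A) :
    toRoughSet (imp a b) = imp (toRoughSet a) (toRoughSet b) := by
  refine RoughSet.ext (Set.ext fun p => ?_) (Set.ext fun p => ?_)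
  · refine p.1.2.imp_mem_iff.trans ⟨fun h q hq => ?_, fun h G hG hpG ha => ?_⟩
    · exact (em (a ∈ q.1.1)).symm.imp id (h q.1.1 q.1.2 hq)
    · exact (h (show ((⟨G, hG⟩, true) : Point A) ∈ Set.Ici p from hpG)).resolve_left
        (not_not_intro ha)
  · refine (not_congr p.1.2.sneg_imp_mem_iff).trans ?_
    rw [not_and_or]
    rfl

variable (A) in
/-- The image of `A` in the rough sets of its points. -/
def roughSubalgebra : NelsonSubalgebra (RoughSet (Point A)) where
  carrier := Set.range toRoughSet
  inf_mem' := by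
    rintro _ _ ⟨a, rfl⟩ ⟨b, rfl⟩
    exact ⟨_, toRoughSet_inf a b⟩
  sup_mem' := by
    rintro _ _ ⟨a, rfl⟩ ⟨b, rfl⟩
    exact ⟨_, toRoughSet_sup a b⟩
  imp_mem' := by
    rintro _ _ ⟨a, rfl⟩ ⟨b, rfl⟩
    exact ⟨_, toRoughSet_imp a b⟩
  sneg_mem' := by
    rintro _ ⟨a, rfl⟩
    exact ⟨_, toRoughSet_sneg a⟩
  bot_mem' := ⟨_, toRoughSet_bot⟩
  top_mem' := ⟨_, toRoughSet_top⟩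

variable (A) in
/-- A Nelson algebra is isomorphic to its image in the rough sets of its points. -/
noncomputable def equivRoughSubalgebra : NelsonEquiv A (roughSubalgebra A).carrier where
  toEquiv := Equiv.ofInjective toRoughSet toRoughSet_injective
  map_inf' a b := Subtype.ext (toRoughSet_inf a b)
  map_sup' a b := Subtype.ext (toRoughSet_sup a b)
  map_imp' a b := Subtype.ext (toRoughSet_imp a b)
  map_sneg' a := Subtype.ext (toRoughSet_sneg a)
  map_bot' := Subtype.ext toRoughSet_bot
  map_top' := Subtype.ext toRoughSet_top

end Representation

end NelsonAlgebra

theorem mainTheorem1 (A : Type u) [NelsonAlgebra A] :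
    ∃ (U : Type u) (_ : Preorder U) (S : NelsonSubalgebra (RoughSet U)),
      Nonempty (NelsonEquiv A S.carrier) :=
  ⟨NelsonAlgebra.Point A, inferInstance, NelsonAlgebra.roughSubalgebra A,
    ⟨NelsonAlgebra.equivRoughSubalgebra A⟩⟩
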